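/- Let $d\ge 2$, $\alpha>d$, $M>0$, and put $a=\frac{3(d+1)}{\min\{\alpha-d,1\}}$. Let $|\cdot|$ be the $\ell^1$-norm on $\mathbb{Z}^d$, $\mathrm{dist}$ the corresponding distance between sets, and let connectedness in $\mathbb{Z}^d$ refer to nearest neighbours. For a finite set $A\subset\mathbb{Z}^d$ write $|A|$ for its cardinality and let $V(A)$ be the complement in $\mathbb{Z}^d$ of the unbounded connected component of $\mathbb{Z}^d\setminus A$. An $(M,a)$-partition of $A$ is a partition $\Gamma$ of $A$ into non-empty sets such that $$\mathrm{dist}(B,C)>M\min\{|V(B)|,|V(C)|\}^{\frac{a}{d+1}}\qquad\text{for all distinct }B,C\in\Gamma .$$ Every finite $A$ has a unique finest $(M,a)$-partition, denoted $\Gamma(A)$. For an integer $q\ge 2$ and a configuration $\sigma:\mathbb{Z}^d\to\mathbb{Z}_q$, let $\partial\sigma$ be the set of those $x$ for which $\sigma$ is not constant on the ball $\{z\in\mathbb{Z}^d:|z-x|\le 1\}$. A contour is a pair $\gamma=(\overline\gamma,\sigma|_{\overline\gamma})$, where $\sigma$ is a configuration with $\partial\sigma$ finite and $\overline\gamma\in\Gamma(\partial\sigma)$;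 put $|\gamma|=|\overline\gamma|$ and $V(\gamma)=V(\overline\gamma)$. For $y\in\mathbb{Z}^d$ and $n\ge 1$ let $\mathcal{C}_y(n)$ be the set of all contours $\gamma$ with $y\in V(\gamma)$ and $|\gamma|=n$. Then there is a constant $c_1=c_1(d,M,\alpha)>0$ such that for every integer $q\ge 2$, every $y\in\mathbb{Z}^d$ and every $n\ge 1$ the set $\mathcal{C}_y(n)$ is finite and $$|\mathcal{C}_y(n)|\le e^{(\log q+c_1)n}.$$ -/

import Mathlib

namespace PottsContour

/-- The `ℓ¹` distance on `ℤ^d`. -/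
def l1Dist {d : ℕ} (x y : Fin d → ℤ) : ℕ := ∑ i, (x i - y i).natAbs

/-- The nearest-neighbour graph of `ℤ^d`. -/
def lattice (d : ℕ) : SimpleGraph (Fin d → ℤ) where
  Adj x y := l1Dist x y = 1
  symm := ⟨fun x y h => by
    have e : l1Dist y x = l1Dist x y :=
      Finset.sum_congr rfl fun i _ => by omega
    rw [e]; exact h⟩
  loopless := ⟨fun x h => by simp [l1Dist] at h⟩

/-- The graph of `ℤ^d` restricted to the complement of `A`. -/
def complGraph {d : ℕ} (A : Finset (Fin d → ℤ)) :
    SimpleGraph {x : Fin d → ℤ // x ∉ A} :=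
  (lattice d).comap Subtype.val

/-- The unbounded part `A⁽⁰⁾` of the complement of `A`: all points whose connected component in the
complement of `A` is infinite. (For `2 ≤ d` there is exactly one such component.) -/
def exterior {d : ℕ} (A : Finset (Fin d → ℤ)) : Set (Fin d → ℤ) :=
  {x | ∃ hx : x ∉ A, ((complGraph A).connectedComponentMk ⟨x, hx⟩).supp.Infinite}

/-- The volume `V(A)` of a finite set `A`. -/
def volume {d : ℕ} (A : Finset (Fin d → ℤ)) : Set (Fin d → ℤ) := (exterior A)ᶜ

/-- The distance between two (non-empty) finite sets, with respect to the `ℓ¹` norm. -/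
noncomputable def setDist {d : ℕ} (A B : Finset (Fin d → ℤ)) : ℕ :=
  sInf {r | ∃ x ∈ A, ∃ y ∈ B, r = l1Dist x y}

/-- `P` is an `(M, a)`-partition of `A`. -/
def IsMAPartition {d : ℕ} (M a : ℝ) {A : Finset (Fin d → ℤ)} (P : Finpartition A) : Prop :=
  ∀ B ∈ P.parts, ∀ C ∈ P.parts, B ≠ C →
    M * (min ((volume B).ncard : ℝ) ((volume C).ncard : ℝ)) ^ (a / ((d : ℝ) + 1))
      < (setDist B C : ℝ)

/-- `P` is the finest `(M, a)`-partition of `A`. In Mathlib's order on `Finpartition A`, `P ≤ Q`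
means that every part of `P` is contained in a part of `Q`. -/
def IsFinestMAPartition {d : ℕ} (M a : ℝ) {A : Finset (Fin d → ℤ)} (P : Finpartition A) : Prop :=
  IsLeast {Q : Finpartition A | IsMAPartition M a Q} P

/-- The exponent `a(α, d) = 3 (d + 1) / min (α - d) 1`. -/
noncomputable def expo (α : ℝ) (d : ℕ) : ℝ := 3 * ((d : ℝ) + 1) / min (α - d) 1

/-- The boundary `∂σ`: the set of points that are not `r`-correct for any `r`. -/
def boundary {d q : ℕ} (σ : (Fin d → ℤ) → ZMod q) : Set (Fin d → ℤ) :=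
  {x | ¬ ∃ r : ZMod q, ∀ y, l1Dist y x ≤ 1 → σ y = r}

/-- A pair consisting of a finite set of sites and a spin configuration on it. -/
abbrev SpinPair (d q : ℕ) : Type := Σ A : Finset (Fin d → ℤ), ({x // x ∈ A} → ZMod q)

/-- `γ` is a contour of the configuration `σ`, which has a finite boundary. -/
def IsContourOf {d q : ℕ} (M a : ℝ) (σ : (Fin d → ℤ) → ZMod q) (γ : SpinPair d q) : Prop :=
  ∃ (h : (boundary σ).Finite) (P : Finpartition h.toFinset),
    IsFinestMAPartition M a P ∧ γ.1 ∈ P.parts ∧ ∀ x : {x // x ∈ γ.1}, γ.2 x = σ x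

/-- The set `𝒞_y(n)` of all contours (of configurations with finite boundary) of size `n` whose
volume contains `y`. -/
def contours {d : ℕ} (q : ℕ) (M a : ℝ) (y : Fin d → ℤ) (n : ℕ) : Set (SpinPair d q) :=
  {γ | (∃ σ : (Fin d → ℤ) → ZMod q, IsContourOf M a σ γ) ∧ y ∈ volume γ.1 ∧ γ.1.card = n}

/-! The volume is monotone and finite, and hence a finest `(M, a)`-partition always exists. -/

theorem volume_mono {d : ℕ} {A B : Finset (Fin d → ℤ)} (h : A ⊆ B) : volume A ⊆ volume B := by
  refine Set.compl_subset_compl.2 ?_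
  rintro x ⟨hx, hinf⟩
  refine ⟨fun hA => hx (h hA), ?_⟩
  let f : complGraph B →g complGraph A :=
    { toFun := fun z => ⟨z.1, fun hz => z.2 (h hz)⟩
      map_rel' := fun {a b} hab => hab }
  have hf : Function.Injective f := fun a b hab => Subtype.ext (congrArg (fun z => z.1) hab)
  refine (hinf.image (f := f) hf.injOn).mono ?_
  rintro _ ⟨z, hz, rfl⟩
  have hz' : (complGraph B).Reachable z ⟨x, hx⟩ := SimpleGraph.ConnectedComponent.exact hz
  exact SimpleGraph.ConnectedComponent.sound (hz'.map f)

theorem mem_exterior_of_large {d : ℕ} {A : Finset (Fin d → ℤ)} {x : Fin d → ℤ} (i : Fin d)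
    (s : ℤ) (hs : s = 1 ∨ s = -1) (hx : ∀ z ∈ A, s * z i < s * x i) : x ∈ exterior A := by
  have hmem : ∀ t : ℕ, Function.update x i (x i + s * t) ∉ A := by
    intro t ht
    have := hx _ ht
    simp only [Function.update_self] at this
    rcases hs with rfl | rfl <;> omega
  let p : ℕ → {x : Fin d → ℤ // x ∉ A} := fun t => ⟨_, hmem t⟩
  have hp0 : (p 0).1 = x := by simp [p]
  have hadj : ∀ t, (complGraph A).Adj (p t) (p (t + 1)) := by
    intro t
    change ∑ j, ((Function.update x i (x i + s * t)) j
      - (Function.update x i (x i + s * ((t + 1 : ℕ) : ℤ))) j).natAbs = 1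
    rw [Finset.sum_eq_single i]
    · simp only [Function.update_self]
      push_cast
      rcases hs with rfl | rfl <;> omega
    · intro j _ hj
      simp [Function.update_of_ne hj]
    · simp
  have hreach : ∀ t, (complGraph A).Reachable (p t) (p 0) := by
    intro t
    induction t with
    | zero => exact SimpleGraph.Reachable.refl _
    | succ t ih => exact (hadj t).symm.reachable.trans ih
  have hinj : Function.Injective p := by
    intro t u htu
    have := congrFun (congrArg Subtype.val htu) i
    simp only [p, Function.update_self] at this
    rcases hs with rfl | rfl <;> omega
  have hx0 : x ∉ A := by rw [← hp0]; exact (p 0).2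
  have hpx : p 0 = ⟨x, hx0⟩ := Subtype.ext hp0
  refine ⟨hx0, (Set.infinite_range_of_injective hinj).mono ?_⟩
  rintro _ ⟨t, rfl⟩
  rw [← hpx]
  exact SimpleGraph.ConnectedComponent.sound (hreach t)

theorem volume_finite {d : ℕ} (A : Finset (Fin d → ℤ)) : (volume A).Finite := by
  obtain ⟨R, hR⟩ : ∃ R : ℕ, ∀ z ∈ A, ∀ i, (z i).natAbs ≤ R := by
    refine ⟨∑ z ∈ A, ∑ i, (z i).natAbs, fun z hz i => ?_⟩
    calc (z i).natAbs ≤ ∑ i, (z i).natAbs :=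
          Finset.single_le_sum (f := fun i => (z i).natAbs) (fun _ _ => Nat.zero_le _)
            (Finset.mem_univ i)
      _ ≤ _ := Finset.single_le_sum (f := fun z : Fin d → ℤ => ∑ i, (z i).natAbs)
            (fun _ _ => Nat.zero_le _) hz
  refine (Set.finite_Icc (fun _ : Fin d => -(R : ℤ)) (fun _ => (R : ℤ))).subset ?_
  intro x hx
  refine ⟨fun i => ?_, fun i => ?_⟩
  · by_contra hlt
    simp only [not_le] at hlt
    exact hx (mem_exterior_of_large i (-1) (Or.inr rfl) fun z hz => by
      have := hR z hz i; omega)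
  · by_contra hlt
    simp only [not_le] at hlt
    exact hx (mem_exterior_of_large i 1 (Or.inl rfl) fun z hz => by
      have := hR z hz i; omega)

theorem setDist_mono {d : ℕ} {A A' B B' : Finset (Fin d → ℤ)} (hA : A' ⊆ A) (hB : B' ⊆ B)
    (hA' : A'.Nonempty) (hB' : B'.Nonempty) : setDist A B ≤ setDist A' B' := by
  obtain ⟨a, ha⟩ := hA'
  obtain ⟨b, hb⟩ := hB'
  obtain ⟨x, hx, y, hy, e⟩ := Nat.sInf_mem (s := {r | ∃ x ∈ A', ∃ y ∈ B', r = l1Dist x y})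
    ⟨_, a, ha, b, hb, rfl⟩
  exact Nat.sInf_le ⟨x, hA hx, y, hB hy, e⟩

theorem IsMAPartition.inf {d : ℕ} {M a : ℝ} (hM : 0 ≤ M) (ha : 0 ≤ a) {A : Finset (Fin d → ℤ)}
    {P Q : Finpartition A} (hP : IsMAPartition M a P) (hQ : IsMAPartition M a Q) :
    IsMAPartition M a (P ⊓ Q) := by
  have key : ∀ (R : Finpartition A), IsMAPartition M a R → ∀ B ∈ R.parts, ∀ C ∈ R.parts, B ≠ C →
      ∀ B' C' : Finset (Fin d → ℤ), B' ⊆ B → C' ⊆ C → B'.Nonempty → C'.Nonempty →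
      M * (min ((volume B').ncard : ℝ) ((volume C').ncard : ℝ)) ^ (a / ((d : ℝ) + 1))
        < (setDist B' C' : ℝ) := by
    intro R hR B hB C hC hne B' C' hB' hC' nB nC
    have h1 : ((volume B').ncard : ℝ) ≤ (volume B).ncard := by
      exact_mod_cast Set.ncard_le_ncard (volume_mono hB') (volume_finite B)
    have h2 : ((volume C').ncard : ℝ) ≤ (volume C).ncard := by
      exact_mod_cast Set.ncard_le_ncard (volume_mono hC') (volume_finite C)
    have h3 : ((setDist B C : ℕ) : ℝ) ≤ setDist B' C' := by
      exact_mod_cast setDist_mono hB' hC' nB nC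
    refine lt_of_le_of_lt ?_ (lt_of_lt_of_le (hR B hB C hC hne) h3)
    refine mul_le_mul_of_nonneg_left ?_ hM
    exact Real.rpow_le_rpow (by positivity) (min_le_min h1 h2) (by positivity)
  intro B' hB' C' hC' hne
  have nB : B'.Nonempty := Finset.nonempty_iff_ne_empty.2 ((P ⊓ Q).ne_bot hB')
  have nC : C'.Nonempty := Finset.nonempty_iff_ne_empty.2 ((P ⊓ Q).ne_bot hC')
  rw [Finpartition.parts_inf, Finset.mem_erase, Finset.mem_image] at hB' hC'
  obtain ⟨-, ⟨B1, B2⟩, hB, rfl⟩ := hB'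
  obtain ⟨-, ⟨C1, C2⟩, hC, rfl⟩ := hC'
  rw [Finset.mem_product] at hB hC
  by_cases h1 : B1 = C1
  · have h2 : B2 ≠ C2 := fun h2 => hne (by simp only [h1, h2])
    exact key Q hQ B2 hB.2 C2 hC.2 h2 _ _ Finset.inter_subset_right Finset.inter_subset_right nB nC
  · exact key P hP B1 hB.1 C1 hC.1 h1 _ _ Finset.inter_subset_left Finset.inter_subset_left nB nC

theorem exists_isFinestMAPartition {d : ℕ} {M a : ℝ} (hM : 0 ≤ M) (ha : 0 ≤ a)
    (A : Finset (Fin d → ℤ)) : ∃ P : Finpartition A, IsFinestMAPartition M a P := by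
  classical
  let S : Finset (Finpartition A) := Finset.univ.filter fun Q => IsMAPartition M a Q
  refine ⟨S.inf id, ?_, fun Q hQ => ?_⟩
  · refine Finset.inf_induction (p := fun Q => IsMAPartition M a Q) ?_ ?_ ?_
    · intro B hB C hC hne
      exact absurd (Finpartition.parts_top_subsingleton A hB hC) hne
    · intro P hP Q hQ
      exact hP.inf hM ha hQ
    · intro Q hQ
      exact (Finset.mem_filter.1 hQ).2
  · exact Finset.inf_le (f := id) (Finset.mem_filter.2 ⟨Finset.mem_univ _, hQ⟩)

end PottsContour

/-!
A part of the finest partition cannot be cut into two pieces that satisfy the distance condition, and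
a point of `V(B)` is determined by two points of `B` (`ncard_volume_le`), so `|V(B)| ≤ |B| ^ 2`.
Hence the support `G` of a contour has short gaps: whenever `G` is split into `B` and `G \ B`, some
pair of points across the splitting has distance at most `M * min |B| |G \ B| ^ s`, where `s` depends
only on `d` and `α` (`IsFinestMAPartition.hasShortGaps`).

To count such sets, build a spanning tree of `G` greedily, starting from single points and always
joining the smallest cluster, with `k` points say, to another one. The new edge has length at most
`M * k ^ s`, and the logarithm of this is `O(√k)`. Since the merged clusters have at least `k` points
each, the sum of `√|cluster|` over all clusters drops by a multiple of `√k`, so the logarithms of the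
edge lengths add up to `O(n)`, where `n = |G|`. Going around the tree gives a closed walk of
`2 * n - 2` steps that visits exactly `G` and has logarithmic cost `O(n)`
(`HasShortGaps.hasCheapTours`).

The walks of `m` steps and logarithmic cost at most `c` are counted by giving a step `v` the summable
weight `∏ i, (1 + |v i|) ^ (-2)`: a walk has weight at least `exp (-2dc)`, and the total weight is at
most `W ^ m` (`exists_card_cheap_walks_le`). If `y ∈ V(G)`, then the two rays from `y` in directions
`±e₀` meet `G`, so `y` is joined to `G` by a step no longer than the distance between two points of
`G`. By subadditivity this costs no more than the tour (`HasShortGaps.exists_walk`). So there are at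
most `exp (c n)` supports, each of which carries at most `q ^ n` spin configurations.
-/

namespace PottsContour

/-! ### The volume of a finite set -/

/-- A point of the volume cannot escape to infinity along a coordinate ray. -/
theorem exists_ray_mem_of_mem_volume {d : ℕ} {A : Finset (Fin d → ℤ)} {x : Fin d → ℤ}
    (hx : x ∈ volume A) (i : Fin d) {s : ℤ} (hs : s = 1 ∨ s = -1) :
    ∃ t : ℕ, Function.update x i (x i + s * t) ∈ A := by
  by_contra! hmem
  refine hx ?_
  let p : ℕ → {x : Fin d → ℤ // x ∉ A} := fun t => ⟨_, hmem t⟩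
  have hp0 : (p 0).1 = x := by simp [p]
  have hadj : ∀ t, (complGraph A).Adj (p t) (p (t + 1)) := by
    intro t
    change ∑ j, ((Function.update x i (x i + s * t)) j
      - (Function.update x i (x i + s * ((t + 1 : ℕ) : ℤ))) j).natAbs = 1
    rw [Finset.sum_eq_single i]
    · simp only [Function.update_self]
      push_cast
      rcases hs with rfl | rfl <;> omega
    · intro j _ hj
      simp [Function.update_of_ne hj]
    · simp
  have hreach : ∀ t, (complGraph A).Reachable (p t) (p 0) := by
    intro t
    induction t with
    | zero => exact SimpleGraph.Reachable.refl _
    | succ t ih => exact (hadj t).symm.reachable.trans ih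
  have hinj : Function.Injective p := by
    intro t u htu
    have := congrFun (congrArg Subtype.val htu) i
    simp only [p, Function.update_self] at this
    rcases hs with rfl | rfl <;> omega
  have hx0 : x ∉ A := by rw [← hp0]; exact (p 0).2
  have hpx : p 0 = ⟨x, hx0⟩ := Subtype.ext hp0
  refine ⟨hx0, (Set.infinite_range_of_injective hinj).mono ?_⟩
  rintro _ ⟨t, rfl⟩
  rw [← hpx]
  exact SimpleGraph.ConnectedComponent.sound (hreach t)

/-- A point of the volume is determined by the points of `A` on the rays from it in two different
coordinate directions. -/
theorem ncard_volume_le {d : ℕ} (hd : 2 ≤ d) (A : Finset (Fin d → ℤ)) :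
    (volume A).ncard ≤ A.card ^ 2 := by
  let i : Fin d := ⟨0, by omega⟩
  let j : Fin d := ⟨1, by omega⟩
  have hij : i ≠ j := by simp [i, j]
  have hsub : volume A ⊆
      ((A ×ˢ A).image fun z => Function.update z.1 i (z.2 i) : Finset (Fin d → ℤ)) := by
    intro x hx
    obtain ⟨t, ht⟩ := exists_ray_mem_of_mem_volume hx i (Or.inl rfl)
    obtain ⟨u, hu⟩ := exists_ray_mem_of_mem_volume hx j (Or.inl rfl)
    simp only [Finset.coe_image, Set.mem_image, Finset.mem_coe, Finset.mem_product]
    refine ⟨(Function.update x i (x i + 1 * t), Function.update x j (x j + 1 * u)), ⟨ht, hu⟩, ?_⟩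
    ext k
    by_cases hk : k = i
    · subst hk
      exact (Function.update_self ..).trans (Function.update_of_ne hij (x j + 1 * (u : ℤ)) x)
    · exact (Function.update_of_ne hk ..).trans (Function.update_of_ne hk ..)
  calc (volume A).ncard ≤ _ := Set.ncard_le_ncard hsub (Finset.finite_toSet _)
    _ ≤ (A ×ˢ A).card := by rw [Set.ncard_coe_finset]; exact Finset.card_image_le
    _ = A.card ^ 2 := by rw [Finset.card_product, sq]

/-! ### Parts of the finest partition cannot be split -/

/-- Otherwise cutting `G` into `B` and `G \ B` would refine the finest partition. -/
theorem IsFinestMAPartition.setDist_sdiff_le {d : ℕ} {M a : ℝ} (hM : 0 ≤ M) (ha : 0 ≤ a)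
    {A : Finset (Fin d → ℤ)} {P : Finpartition A} (hP : IsFinestMAPartition M a P)
    {G : Finset (Fin d → ℤ)} (hG : G ∈ P.parts) {B : Finset (Fin d → ℤ)} (hBG : B ⊂ G)
    (hB : B.Nonempty) :
    (setDist B (G \ B) : ℝ) ≤
      M * (min ((volume B).ncard : ℝ) ((volume (G \ B)).ncard : ℝ)) ^ (a / ((d : ℝ) + 1)) := by
  by_contra! hlt
  have hGA : G ⊆ A := P.le hG
  have hGB : (G \ B).Nonempty := Finset.sdiff_nonempty.2 hBG.2
  let R : Finpartition A := (Finpartition.indiscrete hB.ne_empty).extend (b := A \ B)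
    (hGB.mono (Finset.sdiff_subset_sdiff hGA subset_rfl)).ne_empty Finset.disjoint_sdiff
    (Finset.union_sdiff_of_subset (hBG.1.trans hGA))
  have hR : ∀ X, X ∈ R.parts ↔ X = A \ B ∨ X = B := by
    intro X; simp [R, Finpartition.extend]
  have hinf : ∀ X ∈ (P ⊓ R).parts, (X ∈ P.parts ∧ X ≠ G) ∨ X = B ∨ X = G \ B := by
    intro X hX
    have nX : X ≠ ∅ := (P ⊓ R).ne_bot hX
    rw [Finpartition.parts_inf, Finset.mem_erase, Finset.mem_image] at hX
    obtain ⟨-, ⟨X1, X2⟩, h, rfl⟩ := hX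
    rw [Finset.mem_product, hR] at h
    obtain ⟨h1, h2⟩ := h
    simp only at h1 h2 nX ⊢
    have h1A : X1 ⊆ A := P.le h1
    by_cases hXG : X1 = G
    · subst hXG
      rcases h2 with rfl | rfl
      · right; right
        ext x; have := @h1A x; simp; tauto
      · right; left
        exact Finset.inter_eq_right.2 hBG.1
    · have hdis : Disjoint X1 G := P.disjoint h1 hG hXG
      have hdisB : Disjoint X1 B := hdis.mono_right hBG.1
      rcases h2 with rfl | rfl
      · left
        have : X1 ⊓ (A \ B) = X1 := by
          refine Finset.inter_eq_left.2 fun x hx => ?_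
          exact Finset.mem_sdiff.2 ⟨h1A hx, Finset.disjoint_left.1 hdisB hx⟩
        rw [this]
        exact ⟨h1, hXG⟩
      · exact absurd (Finset.disjoint_iff_inter_eq_empty.1 hdisB) nX
  -- Shrinking the sets increases their distance and decreases their volumes.
  have key : ∀ X ∈ P.parts, ∀ Y ∈ P.parts, X ≠ Y → ∀ X' Y' : Finset (Fin d → ℤ), X' ⊆ X → Y' ⊆ Y →
      X'.Nonempty → Y'.Nonempty →
      M * (min ((volume X').ncard : ℝ) ((volume Y').ncard : ℝ)) ^ (a / ((d : ℝ) + 1))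
        < (setDist X' Y' : ℝ) := by
    intro X hX Y hY hne X' Y' hX' hY' nX nY
    have h1 : ((volume X').ncard : ℝ) ≤ (volume X).ncard := by
      exact_mod_cast Set.ncard_le_ncard (volume_mono hX') (volume_finite X)
    have h2 : ((volume Y').ncard : ℝ) ≤ (volume Y).ncard := by
      exact_mod_cast Set.ncard_le_ncard (volume_mono hY') (volume_finite Y)
    have h3 : ((setDist X Y : ℕ) : ℝ) ≤ setDist X' Y' := by
      exact_mod_cast setDist_mono hX' hY' nX nY
    refine lt_of_le_of_lt ?_ (lt_of_lt_of_le (hP.1 X hX Y hY hne) h3)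
    gcongr
  have hcomm : setDist (G \ B) B = setDist B (G \ B) := by
    have hsymm : ∀ x y : Fin d → ℤ, l1Dist x y = l1Dist y x := fun x y =>
      Finset.sum_congr rfl fun i _ => by omega
    unfold setDist
    congr 1
    ext r
    constructor <;> rintro ⟨x, hx, y, hy, rfl⟩ <;> exact ⟨y, hy, x, hx, hsymm _ _⟩
  -- `R` itself need not be an `(M, a)`-partition, but `P ⊓ R` is one: it only cuts `G`.
  have hQ : IsMAPartition M a (P ⊓ R) := by
    intro X hX Y hY hne
    have nX : X.Nonempty := Finset.nonempty_iff_ne_empty.2 ((P ⊓ R).ne_bot hX)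
    have nY : Y.Nonempty := Finset.nonempty_iff_ne_empty.2 ((P ⊓ R).ne_bot hY)
    have hsub : ∀ Z, Z = B ∨ Z = G \ B → Z ⊆ G := by
      rintro Z (rfl | rfl)
      exacts [hBG.1, Finset.sdiff_subset]
    rcases hinf X hX with ⟨hX1, hX2⟩ | hX1 <;> rcases hinf Y hY with ⟨hY1, hY2⟩ | hY1
    · exact hP.1 X hX1 Y hY1 hne
    · exact key X hX1 G hG hX2 X Y subset_rfl (hsub Y hY1) nX nY
    · exact key G hG Y hY1 hY2.symm X Y (hsub X hX1) subset_rfl nX nY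
    · rcases hX1 with rfl | rfl <;> rcases hY1 with rfl | rfl
      · exact absurd rfl hne
      · exact hlt
      · rw [min_comm, hcomm]; exact hlt
      · exact absurd rfl hne
  obtain ⟨X, hX, hGX⟩ := ((hP.2 hQ).trans inf_le_right : P ≤ R) hG
  rcases (hR X).1 hX with rfl | rfl
  · obtain ⟨b, hb⟩ := hB
    exact (Finset.mem_sdiff.1 (hGX (hBG.1 hb))).2 hb
  · exact hBG.2 hGX

/-- A set has short gaps if each of its non-trivial splittings `B`, `G \ B` is bridged by a pair of
points at distance at most `M * min |B| |G \ B| ^ s`. -/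
def HasShortGaps {d : ℕ} (M s : ℝ) (G : Finset (Fin d → ℤ)) : Prop :=
  ∀ B ⊂ G, B.Nonempty → ∃ b ∈ B, ∃ c ∈ G \ B,
    (l1Dist b c : ℝ) ≤ M * (min (B.card : ℝ) ((G \ B).card : ℝ)) ^ s

theorem IsFinestMAPartition.hasShortGaps {d : ℕ} (hd : 2 ≤ d) {M a : ℝ} (hM : 0 ≤ M) (ha : 0 ≤ a)
    {A : Finset (Fin d → ℤ)} {P : Finpartition A} (hP : IsFinestMAPartition M a P)
    {G : Finset (Fin d → ℤ)} (hG : G ∈ P.parts) :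
    HasShortGaps M (2 * (a / ((d : ℝ) + 1))) G := by
  intro B hBG hB
  have hGB : (G \ B).Nonempty := Finset.sdiff_nonempty.2 hBG.2
  obtain ⟨b, hb⟩ := id hB
  obtain ⟨c, hc⟩ := id hGB
  obtain ⟨x, hx, y, hy, e⟩ := Nat.sInf_mem (s := {r | ∃ x ∈ B, ∃ y ∈ G \ B, r = l1Dist x y})
    ⟨_, b, hb, c, hc, rfl⟩
  refine ⟨x, hx, y, hy, ?_⟩
  have h := hP.setDist_sdiff_le hM ha hG hBG hB
  rw [setDist, e] at h
  refine h.trans ?_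
  have hvol : ∀ X : Finset (Fin d → ℤ), ((volume X).ncard : ℝ) ≤ (X.card : ℝ) ^ 2 := fun X => by
    exact_mod_cast ncard_volume_le hd X
  have hmin : min ((volume B).ncard : ℝ) ((volume (G \ B)).ncard : ℝ) ≤
      (min (B.card : ℝ) ((G \ B).card : ℝ)) ^ 2 := by
    rcases le_total (B.card : ℝ) ((G \ B).card : ℝ) with h | h
    · rw [min_eq_left h]; exact (min_le_left _ _).trans (hvol B)
    · rw [min_eq_right h]; exact (min_le_right _ _).trans (hvol _)
  rw [Real.rpow_mul (by positivity), Real.rpow_two]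
  gcongr

/-! ### Tours -/

/-- The logarithmic cost of a step `v` of `ℤ^d`. -/
noncomputable def stepCost {d : ℕ} (v : Fin d → ℤ) : ℝ := Real.log (1 + (l1Dist v 0 : ℝ))

theorem stepCost_nonneg {d : ℕ} (v : Fin d → ℤ) : 0 ≤ stepCost v :=
  Real.log_nonneg (by simp)

theorem stepCost_sub_comm {d : ℕ} (x y : Fin d → ℤ) : stepCost (x - y) = stepCost (y - x) := by
  have : l1Dist (x - y) 0 = l1Dist (y - x) 0 :=
    Finset.sum_congr rfl fun i _ => by simp only [Pi.sub_apply, Pi.zero_apply]; omega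
  rw [stepCost, this, stepCost]

theorem stepCost_add_le {d : ℕ} (u v : Fin d → ℤ) :
    stepCost (u + v) ≤ stepCost u + stepCost v := by
  have h : l1Dist (u + v) 0 ≤ l1Dist u 0 + l1Dist v 0 := by
    unfold l1Dist
    rw [← Finset.sum_add_distrib]
    refine Finset.sum_le_sum fun i _ => ?_
    simp only [Pi.add_apply, Pi.zero_apply]; omega
  have h' : (l1Dist (u + v) 0 : ℝ) ≤ l1Dist u 0 + l1Dist v 0 := by exact_mod_cast h
  rw [stepCost, stepCost, stepCost, ← Real.log_mul (by positivity) (by positivity)]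
  refine Real.log_le_log (by positivity) ?_
  nlinarith [mul_nonneg (Nat.cast_nonneg (α := ℝ) (l1Dist u 0))
    (Nat.cast_nonneg (α := ℝ) (l1Dist v 0))]

/-- The total cost of a list of steps. -/
noncomputable def walkCost {d : ℕ} (l : List (Fin d → ℤ)) : ℝ := (l.map stepCost).sum

@[simp] theorem walkCost_nil {d : ℕ} : walkCost ([] : List (Fin d → ℤ)) = 0 := rfl

@[simp] theorem walkCost_cons {d : ℕ} (v : Fin d → ℤ) (l : List (Fin d → ℤ)) :
    walkCost (v :: l) = stepCost v + walkCost l := by simp [walkCost]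

@[simp] theorem walkCost_append {d : ℕ} (l l' : List (Fin d → ℤ)) :
    walkCost (l ++ l') = walkCost l + walkCost l' := by simp [walkCost]

theorem walkCost_nonneg {d : ℕ} (l : List (Fin d → ℤ)) : 0 ≤ walkCost l := by
  induction l with
  | nil => simp
  | cons v l ih => rw [walkCost_cons]; exact add_nonneg (stepCost_nonneg v) ih

theorem stepCost_sum_le {d : ℕ} (l : List (Fin d → ℤ)) : stepCost l.sum ≤ walkCost l := by
  induction l with
  | nil => simp [stepCost, l1Dist]
  | cons v l ih =>
    rw [List.sum_cons, walkCost_cons]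
    exact (stepCost_add_le _ _).trans (add_le_add le_rfl ih)

/-- The points visited by the walk that starts at `x` and makes the steps of a list. -/
def visited {d : ℕ} (x : Fin d → ℤ) : List (Fin d → ℤ) → Finset (Fin d → ℤ)
  | [] => {x}
  | v :: l => insert x (visited (x + v) l)

theorem start_mem_visited {d : ℕ} (x : Fin d → ℤ) (l : List (Fin d → ℤ)) : x ∈ visited x l := by
  cases l <;> simp [visited]

theorem visited_append {d : ℕ} (x : Fin d → ℤ) (l l' : List (Fin d → ℤ)) :
    visited x (l ++ l') = visited x l ∪ visited (x + l.sum) l' := by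
  induction l generalizing x with
  | nil =>
    simp [visited, start_mem_visited]
  | cons v l ih => simp [visited, ih, add_assoc]

theorem exists_append_of_mem_visited {d : ℕ} {x b : Fin d → ℤ} {l : List (Fin d → ℤ)}
    (hb : b ∈ visited x l) : ∃ l₁ l₂, l = l₁ ++ l₂ ∧ x + l₁.sum = b := by
  induction l generalizing x with
  | nil =>
    rw [visited, Finset.mem_singleton] at hb
    exact ⟨[], [], rfl, by simp [hb]⟩
  | cons v l ih =>
    rw [visited, Finset.mem_insert] at hb
    rcases hb with rfl | hb
    · exact ⟨[], v :: l, rfl, by simp⟩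
    · obtain ⟨l₁, l₂, rfl, h⟩ := ih hb
      exact ⟨v :: l₁, l₂, rfl, by rw [List.sum_cons, ← add_assoc, h]⟩

theorem stepCost_sub_le_walkCost {d : ℕ} {x z : Fin d → ℤ} {l : List (Fin d → ℤ)}
    (hz : z ∈ visited x l) : stepCost (z - x) ≤ walkCost l := by
  obtain ⟨l₁, l₂, rfl, rfl⟩ := exists_append_of_mem_visited hz
  rw [add_sub_cancel_left, walkCost_append]
  have := stepCost_sum_le l₁
  have := walkCost_nonneg l₂
  linarith

/-- `A` has cheap tours if from each of its points there starts a closed walk of `2 * (|A| - 1)`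
steps that visits exactly `A`, at cost at most `μ * (|A| - √|A|)`. -/
def HasCheapTours {d : ℕ} (μ : ℝ) (A : Finset (Fin d → ℤ)) : Prop :=
  ∀ x ∈ A, ∃ l : List (Fin d → ℤ), l.sum = 0 ∧ visited x l = A ∧ l.length + 2 = 2 * A.card ∧
    walkCost l ≤ μ * (A.card - √(A.card : ℝ))

theorem hasCheapTours_singleton {d : ℕ} (μ : ℝ) (x : Fin d → ℤ) : HasCheapTours μ {x} := by
  intro y hy
  rw [Finset.mem_singleton] at hy
  subst hy
  exact ⟨[], by simp, by simp [visited], by simp, by simp⟩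

theorem sqrt_add_le_half_add {b c : ℝ} (hb : 0 ≤ b) (hbc : b ≤ c) :
    √(b + c) ≤ √b / 2 + √c := by
  have hs : √b ≤ √c := Real.sqrt_le_sqrt hbc
  rw [Real.sqrt_le_left (by positivity)]
  nlinarith [Real.sq_sqrt hb, Real.sq_sqrt (hb.trans hbc), Real.sqrt_nonneg b]

/-- Two disjoint sets with cheap tours are joined by a detour along a short bridge. The gain
`√|B| + √|C| - √(|B| + |C|) ≥ √(min |B| |C|) / 2` in the cost bound pays for crossing the bridge
twice. -/
theorem HasCheapTours.exists_detour {d : ℕ} {μ : ℝ} (hμ : 0 ≤ μ) {B C : Finset (Fin d → ℤ)}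
    (hB : HasCheapTours μ B) (hC : HasCheapTours μ C) (hBC : Disjoint B C) {b c : Fin d → ℤ}
    (hb : b ∈ B) (hc : c ∈ C)
    (h : 4 * stepCost (c - b) ≤ μ * √(min (B.card : ℝ) C.card)) {x : Fin d → ℤ} (hx : x ∈ B) :
    ∃ l : List (Fin d → ℤ), l.sum = 0 ∧ visited x l = B ∪ C ∧
      l.length + 2 = 2 * (B ∪ C).card ∧
      walkCost l ≤ μ * ((B ∪ C).card - √((B ∪ C).card : ℝ)) := by
  obtain ⟨l, h0, hv, hl, hw⟩ := hB x hx
  obtain ⟨lC, hC0, hCv, hCl, hCw⟩ := hC c hc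
  rw [← hv] at hb
  obtain ⟨l₁, l₂, rfl, hbdef⟩ := exists_append_of_mem_visited hb
  rw [visited_append, hbdef] at hv
  rw [List.sum_append] at h0
  have hcard : (B ∪ C).card = B.card + C.card := Finset.card_union_of_disjoint hBC
  refine ⟨l₁ ++ ((c - b) :: (lC ++ ((b - c) :: l₂))), ?_, ?_, ?_, ?_⟩
  · simp only [List.sum_append, List.sum_cons, hC0]
    calc _ = l₁.sum + l₂.sum := by abel
      _ = 0 := h0
  · have e1 : b + (c - b) = c := by abel
    have e2 : c + (b - c) = b := by abel
    rw [visited_append, hbdef, visited, visited_append, e1, hC0, add_zero, visited, e2, hCv, ← hv]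
    have := start_mem_visited b l₂
    ext z
    simp only [Finset.mem_union, Finset.mem_insert]
    constructor
    · rintro (h | rfl | h | rfl | h)
      exacts [.inl (.inl h), .inl (.inr this), .inr h, .inr hc, .inl (.inr h)]
    · tauto
  · simp only [List.length_append, List.length_cons] at hl ⊢
    omega
  · simp only [walkCost_append, walkCost_cons] at hw ⊢
    rw [stepCost_sub_comm b c, hcard]
    push_cast
    have hs : √((B.card : ℝ) + C.card) + √(min (B.card : ℝ) C.card) / 2 ≤
        √(B.card : ℝ) + √(C.card : ℝ) := by
      rcases le_total (B.card : ℝ) C.card with h' | h'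
      · rw [min_eq_left h']
        linarith [sqrt_add_le_half_add (by positivity) h']
      · rw [min_eq_right h', add_comm (B.card : ℝ)]
        linarith [sqrt_add_le_half_add (by positivity) h']
    have := mul_le_mul_of_nonneg_left hs hμ
    linarith

theorem HasCheapTours.union {d : ℕ} {μ : ℝ} (hμ : 0 ≤ μ) {B C : Finset (Fin d → ℤ)}
    (hB : HasCheapTours μ B) (hC : HasCheapTours μ C) (hBC : Disjoint B C) {b c : Fin d → ℤ}
    (hb : b ∈ B) (hc : c ∈ C)
    (h : 4 * stepCost (c - b) ≤ μ * √(min (B.card : ℝ) C.card)) : HasCheapTours μ (B ∪ C) := by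
  intro x hx
  rcases Finset.mem_union.1 hx with hx | hx
  · exact hB.exists_detour hμ hC hBC hb hc h hx
  · rw [stepCost_sub_comm, min_comm] at h
    rw [Finset.union_comm]
    exact hC.exists_detour hμ hB hBC.symm hc hb h hx

/-! ### Greedy clustering -/

/-- The cost of a bridge between two clusters, the smaller of which has `k` points. -/
theorem four_mul_stepCost_le {d : ℕ} {M s : ℝ} (hM : 0 ≤ M) (hs : 0 ≤ s) {k : ℝ} (hk : 1 ≤ k)
    {b c : Fin d → ℤ} (h : (l1Dist b c : ℝ) ≤ M * k ^ s) :
    4 * stepCost (c - b) ≤ 4 * (Real.log (1 + M) + 2 * s) * √k := by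
  have hk0 : 0 < k := by linarith
  have h1 : (1 : ℝ) ≤ k ^ s := Real.one_le_rpow hk hs
  have hdist : l1Dist (b - c) 0 = l1Dist b c := by simp [l1Dist]
  have hcost : stepCost (c - b) ≤ Real.log (1 + M) + s * Real.log k := by
    rw [stepCost_sub_comm, stepCost, hdist, ← Real.log_rpow hk0,
      ← Real.log_mul (by positivity) (by positivity)]
    exact Real.log_le_log (by positivity) (by linarith)
  have hsq : 1 ≤ √k := Real.one_le_sqrt.2 hk
  have hlog : Real.log k ≤ 2 * √k := by
    have := Real.log_le_sub_one_of_pos (Real.sqrt_pos.2 hk0)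
    rw [Real.log_sqrt hk0.le] at this
    linarith
  have hlogM : 0 ≤ Real.log (1 + M) := Real.log_nonneg (by linarith)
  nlinarith [mul_le_mul_of_nonneg_left hlog hs, mul_le_mul_of_nonneg_left hsq hlogM]

/-- In a partition of `G` into clusters with cheap tours, the smallest cluster is close to another
one, and the two can be merged. -/
theorem HasShortGaps.hasCheapTours_of_partition {d : ℕ} {M s : ℝ} (hM : 0 ≤ M) (hs : 0 ≤ s)
    {G : Finset (Fin d → ℤ)} (hG : HasShortGaps M s G) (hne : G.Nonempty) (k : ℕ)
    (F : Finset (Finset (Fin d → ℤ))) (hFk : F.card = k) (hFne : ∀ B ∈ F, B.Nonempty)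
    (hdisj : (F : Set (Finset (Fin d → ℤ))).PairwiseDisjoint id) (hU : F.biUnion id = G)
    (hT : ∀ B ∈ F, HasCheapTours (4 * (Real.log (1 + M) + 2 * s)) B) :
    HasCheapTours (4 * (Real.log (1 + M) + 2 * s)) G := by
  induction k generalizing F with
  | zero =>
    rw [Finset.card_eq_zero] at hFk
    subst hFk
    simp at hU
    simp [← hU] at hne
  | succ k ih =>
    have hFne' : F.Nonempty := Finset.card_pos.1 (by omega)
    obtain ⟨B, hB, hmin⟩ := F.exists_min_image Finset.card hFne'
    have hBG : B ⊆ G := hU ▸ Finset.subset_biUnion_of_mem id hB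
    by_cases hBeq : B = G
    · exact hBeq ▸ hT B hB
    obtain ⟨b, hb, c, hc, hbc⟩ := hG B (hBG.ssubset_of_ne hBeq) (hFne B hB)
    obtain ⟨hcG, hcB⟩ := Finset.mem_sdiff.1 hc
    rw [← hU, Finset.mem_biUnion] at hcG
    obtain ⟨C, hC, hcC⟩ := hcG
    rw [id] at hcC
    have hBC : B ≠ C := by rintro rfl; exact hcB hcC
    have hdBC : Disjoint B C := hdisj hB hC hBC
    have hBpos : (1 : ℝ) ≤ B.card := by exact_mod_cast (hFne B hB).card_pos
    have hBC_le : (B.card : ℝ) ≤ C.card := by exact_mod_cast hmin C hC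
    have hbc' : (l1Dist b c : ℝ) ≤ M * (B.card : ℝ) ^ s := by
      refine hbc.trans ?_
      gcongr
      exact min_le_left _ _
    have hμ : 0 ≤ 4 * (Real.log (1 + M) + 2 * s) := by
      have : 0 ≤ Real.log (1 + M) := Real.log_nonneg (by linarith)
      positivity
    have hunion := (hT B hB).union hμ (hT C hC) hdBC hb hcC (by
      rw [min_eq_left hBC_le]
      exact four_mul_stepCost_le hM hs hBpos hbc')
    have hother : ∀ D ∈ (F.erase B).erase C, D ∈ F ∧ Disjoint (B ∪ C) D := by
      intro D hD
      simp only [Finset.mem_erase] at hD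
      obtain ⟨hDC, hDB, hD⟩ := hD
      exact ⟨hD, Finset.disjoint_union_left.2 ⟨hdisj hB hD hDB.symm, hdisj hC hD hDC.symm⟩⟩
    have hnotin : B ∪ C ∉ (F.erase B).erase C := by
      intro h
      have := (hother _ h).2
      rw [disjoint_self] at this
      have hb' : b ∈ B ∪ C := Finset.mem_union_left _ hb
      rw [this] at hb'
      simp at hb'
    refine ih (insert (B ∪ C) ((F.erase B).erase C)) ?_ ?_ ?_ ?_ ?_
    · rw [Finset.card_insert_of_notMem hnotin,
        Finset.card_erase_of_mem (Finset.mem_erase.2 ⟨hBC.symm, hC⟩), Finset.card_erase_of_mem hB]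
      have : 1 < F.card := Finset.one_lt_card.2 ⟨B, hB, C, hC, hBC⟩
      omega
    · intro D hD
      rcases Finset.mem_insert.1 hD with rfl | hD
      · exact ⟨b, Finset.mem_union_left _ hb⟩
      · exact hFne D (hother D hD).1
    · rw [Finset.coe_insert, Set.pairwiseDisjoint_insert]
      refine ⟨hdisj.subset fun D hD => (hother D hD).1, fun D hD _ => (hother D hD).2⟩
    · rw [← hU]
      conv_rhs => rw [← Finset.insert_erase hB,
        ← Finset.insert_erase (Finset.mem_erase.2 ⟨hBC.symm, hC⟩)]
      simp only [Finset.biUnion_insert, id, Finset.union_assoc]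
    · intro D hD
      rcases Finset.mem_insert.1 hD with rfl | hD
      · exact hunion
      · exact hT D (hother D hD).1

theorem HasShortGaps.hasCheapTours {d : ℕ} {M s : ℝ} (hM : 0 ≤ M) (hs : 0 ≤ s)
    {G : Finset (Fin d → ℤ)} (hG : HasShortGaps M s G) :
    HasCheapTours (4 * (Real.log (1 + M) + 2 * s)) G := by
  rcases G.eq_empty_or_nonempty with rfl | hne
  · intro x hx
    simp at hx
  refine hG.hasCheapTours_of_partition hM hs hne _ (G.image fun x => {x}) rfl ?_ ?_ ?_ ?_
  · simp
  · intro X hX Y hY hXY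
    simp only [Finset.coe_image, Set.mem_image] at hX hY
    obtain ⟨x, -, rfl⟩ := hX
    obtain ⟨y, -, rfl⟩ := hY
    exact Finset.disjoint_singleton.2 fun h => hXY (by rw [h])
  · ext; simp
  · simp only [Finset.mem_image]
    rintro _ ⟨x, -, rfl⟩
    exact hasCheapTours_singleton _ x

/-! ### Counting cheap walks -/

/-- The weight of a step. It is a product over the coordinates, so that its sum over `ℤ^d` is the
`d`-th power of a convergent sum over `ℤ`. -/
noncomputable def stepWeight {d : ℕ} (v : Fin d → ℤ) : ℝ := ∏ i, (1 / (1 + |(v i : ℝ)|) ^ 2)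

theorem summable_one_div_one_add_abs_sq :
    Summable fun z : ℤ => 1 / (1 + |(z : ℝ)|) ^ 2 := by
  have h : Summable fun n : ℕ => 1 / (1 + (n : ℝ)) ^ 2 := by
    have := (summable_nat_add_iff 1).2 (Real.summable_one_div_nat_pow.2 (one_lt_two))
    refine this.congr fun n => ?_
    push_cast; ring
  refine Summable.of_nat_of_neg ?_ ?_ <;> simpa using h

theorem exp_neg_le_stepWeight {d : ℕ} (v : Fin d → ℤ) :
    Real.exp (-(2 * d * stepCost v)) ≤ stepWeight v := by
  have hexp : Real.exp (stepCost v) = 1 + (l1Dist v 0 : ℝ) := Real.exp_log (by positivity)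
  have : Real.exp (-(2 * d * stepCost v)) = ∏ _i : Fin d, 1 / (1 + (l1Dist v 0 : ℝ)) ^ 2 := by
    rw [Finset.prod_const, Finset.card_univ, Fintype.card_fin, ← hexp, one_div,
      ← Real.exp_nat_mul, ← Real.exp_neg, ← Real.exp_nat_mul]
    congr 1; push_cast; ring
  rw [this, stepWeight]
  refine Finset.prod_le_prod (fun i _ => by positivity) fun i _ => ?_
  have : |(v i : ℝ)| ≤ l1Dist v 0 := by
    have h1 : (v i).natAbs ≤ l1Dist v 0 := by
      have := Finset.single_le_sum (f := fun i => (v i - (0 : Fin d → ℤ) i).natAbs)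
        (fun _ _ => Nat.zero_le _) (Finset.mem_univ i)
      simpa [l1Dist] using this
    calc |(v i : ℝ)| = ((v i).natAbs : ℝ) := by rw [Nat.cast_natAbs, Int.cast_abs]
      _ ≤ _ := by exact_mod_cast h1
  gcongr

theorem stepWeight_pos {d : ℕ} (v : Fin d → ℤ) : 0 < stepWeight v :=
  (Real.exp_pos _).trans_le (exp_neg_le_stepWeight v)

/-- There are finitely many walks of `m` steps and cost at most `c`. Each has weight at least
`exp (-2dc)`, and the weights of all walks of `m` steps add up to at most `W ^ m`. -/
theorem exists_card_cheap_walks_le (d : ℕ) : ∃ W : ℝ, 1 ≤ W ∧ ∀ (m : ℕ) (c : ℝ),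
    ∃ S : Finset (Fin m → Fin d → ℤ), (∀ f, walkCost (List.ofFn f) ≤ c → f ∈ S) ∧
      (S.card : ℝ) ≤ W ^ m * Real.exp (2 * d * c) := by
  set W₁ : ℝ := 1 + ∑' z : ℤ, 1 / (1 + |(z : ℝ)|) ^ 2 with hW₁
  have htsum : 0 ≤ ∑' z : ℤ, 1 / (1 + |(z : ℝ)|) ^ 2 := tsum_nonneg fun z => by positivity
  refine ⟨W₁ ^ d, one_le_pow₀ (by linarith), fun m c => ?_⟩
  have hcost : ∀ f : Fin m → Fin d → ℤ, walkCost (List.ofFn f) = ∑ j, stepCost (f j) := by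
    intro f
    simp [walkCost, List.map_ofFn, List.sum_ofFn]
  set D : ℤ := ⌈Real.exp c⌉
  let K : Finset (Fin d → ℤ) := Fintype.piFinset fun _ => Finset.Icc (-D) D
  have hK : ∀ v : Fin d → ℤ, stepCost v ≤ c → v ∈ K := by
    intro v hv
    rw [stepCost, Real.log_le_iff_le_exp (by positivity)] at hv
    rw [Fintype.mem_piFinset]
    intro i
    have h1 : (v i).natAbs ≤ l1Dist v 0 := by
      have := Finset.single_le_sum (f := fun i => (v i - (0 : Fin d → ℤ) i).natAbs)
        (fun _ _ => Nat.zero_le _) (Finset.mem_univ i)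
      simpa [l1Dist] using this
    have h2 : ((l1Dist v 0 : ℤ) : ℝ) ≤ D := by
      have := Int.le_ceil (Real.exp c)
      push_cast
      linarith
    have h3 : (l1Dist v 0 : ℤ) ≤ D := by exact_mod_cast h2
    rw [Finset.mem_Icc]
    omega
  have hKsum : ∑ v ∈ K, stepWeight v ≤ W₁ ^ d := by
    unfold stepWeight
    rw [← Finset.prod_univ_sum (fun _ : Fin d => Finset.Icc (-D) D)
      (fun _ z => 1 / (1 + |((z : ℤ) : ℝ)|) ^ 2), Finset.prod_const, Finset.card_univ,
      Fintype.card_fin]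
    refine pow_le_pow_left₀ (Finset.sum_nonneg fun z _ => by positivity) ?_ d
    have := summable_one_div_one_add_abs_sq.sum_le_tsum (Finset.Icc (-D) D)
      (fun z _ => by positivity)
    linarith
  let S : Finset (Fin m → Fin d → ℤ) :=
    (Fintype.piFinset fun _ => K).filter fun f => walkCost (List.ofFn f) ≤ c
  refine ⟨S, fun f hf => ?_, ?_⟩
  · refine Finset.mem_filter.2 ⟨Fintype.mem_piFinset.2 fun j => hK _ ?_, hf⟩
    rw [hcost] at hf
    exact (Finset.single_le_sum (f := fun j => stepCost (f j)) (fun j _ => stepCost_nonneg _)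
      (Finset.mem_univ j)).trans hf
  have hlow : ∀ f ∈ S, Real.exp (-(2 * d * c)) ≤ ∏ j, stepWeight (f j) := by
    intro f hf
    have hf := (Finset.mem_filter.1 hf).2
    rw [hcost] at hf
    calc Real.exp (-(2 * d * c)) ≤ Real.exp (∑ j, -(2 * d * stepCost (f j))) := by
          rw [Real.exp_le_exp, Finset.sum_neg_distrib, ← Finset.mul_sum]
          gcongr
      _ = ∏ j, Real.exp (-(2 * d * stepCost (f j))) := Real.exp_sum _ _
      _ ≤ _ := Finset.prod_le_prod (fun _ _ => by positivity) fun j _ => exp_neg_le_stepWeight _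
  have hsum : (S.card : ℝ) * Real.exp (-(2 * d * c)) ≤ (W₁ ^ d) ^ m := by
    calc (S.card : ℝ) * Real.exp (-(2 * d * c)) = ∑ _f ∈ S, Real.exp (-(2 * d * c)) := by
          rw [Finset.sum_const, nsmul_eq_mul]
      _ ≤ ∑ f ∈ S, ∏ j, stepWeight (f j) := Finset.sum_le_sum hlow
      _ ≤ ∑ f ∈ Fintype.piFinset fun _ : Fin m => K, ∏ j, stepWeight (f j) :=
          Finset.sum_le_sum_of_subset_of_nonneg (Finset.filter_subset _ _) fun f _ _ =>
            Finset.prod_nonneg fun j _ => (stepWeight_pos _).le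
      _ = (∑ v ∈ K, stepWeight v) ^ m := by
          rw [← Finset.prod_univ_sum (fun _ : Fin m => K) (fun _ v => stepWeight v),
            Finset.prod_const, Finset.card_univ, Fintype.card_fin]
      _ ≤ (W₁ ^ d) ^ m :=
          pow_le_pow_left₀ (Finset.sum_nonneg fun v _ => (stepWeight_pos v).le) hKsum m
  rw [Real.exp_neg] at hsum
  have hpos := Real.exp_pos (2 * d * c)
  rwa [← div_eq_mul_inv, div_le_iff₀ hpos] at hsum

/-! ### Counting contours -/

/-- A set with short gaps whose volume contains `y` is visited by a walk from `y`. Its first step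
goes along a coordinate ray to the set, and costs no more than the tour that follows, because the
tour also visits a point on the opposite ray. -/
theorem HasShortGaps.exists_walk {d : ℕ} (hd : 2 ≤ d) {M s : ℝ} (hM : 0 ≤ M) (hs : 0 ≤ s)
    {G : Finset (Fin d → ℤ)} (hG : HasShortGaps M s G) {y : Fin d → ℤ} (hy : y ∈ volume G) :
    ∃ (v : Fin d → ℤ) (l : List (Fin d → ℤ)), visited (y + v) l = G ∧
      (v :: l).length + 1 = 2 * G.card ∧
      walkCost (v :: l) ≤ 8 * (Real.log (1 + M) + 2 * s) * G.card := by
  let i : Fin d := ⟨0, by omega⟩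
  obtain ⟨t, ht⟩ := exists_ray_mem_of_mem_volume hy i (Or.inl rfl)
  obtain ⟨u, hu⟩ := exists_ray_mem_of_mem_volume hy i (Or.inr rfl)
  set z₁ := Function.update y i (y i + 1 * t)
  set z₂ := Function.update y i (y i + -1 * u)
  obtain ⟨l, -, hv, hl, hw⟩ := hG.hasCheapTours hM hs z₁ ht
  have hz₂ : z₂ ∈ visited z₁ l := hv ▸ hu
  have hdist : l1Dist (z₁ - y) 0 ≤ l1Dist (z₂ - z₁) 0 := by
    refine Finset.sum_le_sum fun j _ => ?_
    by_cases hj : j = i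
    · subst hj
      simp only [z₁, z₂, Pi.sub_apply, Function.update_self, Pi.zero_apply]
      omega
    · simp [z₁, Function.update_of_ne hj]
  have hcost : stepCost (z₁ - y) ≤ stepCost (z₂ - z₁) :=
    Real.log_le_log (by positivity) (by gcongr)
  have hcost' := hcost.trans (stepCost_sub_le_walkCost hz₂)
  have hlogM : 0 ≤ Real.log (1 + M) := Real.log_nonneg (by linarith)
  refine ⟨z₁ - y, l, by rw [add_sub_cancel, hv], by rw [List.length_cons]; omega, ?_⟩
  have : 0 ≤ 4 * (Real.log (1 + M) + 2 * s) * √(G.card : ℝ) := by positivity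
  rw [walkCost_cons]
  linarith

/-- The points at which the walk from `y` with the given steps is from its first step on. -/
noncomputable def visitedAfter {d : ℕ} (y : Fin d → ℤ) : List (Fin d → ℤ) → Finset (Fin d → ℤ)
  | [] => ∅
  | v :: l => visited (y + v) l

/-- The number of sets of `n` points with short gaps whose volume contains a given point grows at
most exponentially in `n`. -/
theorem exists_card_hasShortGaps_le {d : ℕ} (hd : 2 ≤ d) {M s : ℝ} (hM : 0 ≤ M) (hs : 0 ≤ s) :
    ∃ c : ℝ, 0 < c ∧ ∀ (y : Fin d → ℤ) (n : ℕ), ∃ S : Finset (Finset (Fin d → ℤ)),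
      (∀ G, HasShortGaps M s G → y ∈ volume G → G.card = n → G ∈ S) ∧
      (S.card : ℝ) ≤ Real.exp (c * n) := by
  obtain ⟨W, hW, hS⟩ := exists_card_cheap_walks_le d
  have hlogM : 0 ≤ Real.log (1 + M) := Real.log_nonneg (by linarith)
  have hlogW : 0 ≤ Real.log W := Real.log_nonneg hW
  set ν := 8 * (Real.log (1 + M) + 2 * s) with hν
  refine ⟨2 * Real.log W + 2 * d * ν + 1, by positivity, fun y n => ?_⟩
  obtain ⟨S, hmem, hcard⟩ := hS (2 * n - 1) (ν * n)
  refine ⟨S.image fun f => visitedAfter y (List.ofFn f), ?_, ?_⟩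
  · rintro G hG hy rfl
    obtain ⟨v, l, hv, hl, hw⟩ := hG.exists_walk hd hM hs hy
    have hlen : (v :: l).length = 2 * G.card - 1 := by omega
    have hofFn : List.ofFn (fun j : Fin (2 * G.card - 1) => (v :: l).get (j.cast hlen.symm)) =
        v :: l := by
      rw [← List.ofFn_congr hlen, List.ofFn_get]
    refine Finset.mem_image.2 ⟨_, hmem _ (by rw [hofFn]; exact hw), ?_⟩
    rw [hofFn]
    exact hv
  · have hW0 : 0 < W := by linarith
    calc ((S.image fun f => visitedAfter y (List.ofFn f)).card : ℝ) ≤ S.card := by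
          exact_mod_cast Finset.card_image_le
      _ ≤ W ^ (2 * n - 1) * Real.exp (2 * d * (ν * n)) := hcard
      _ ≤ W ^ (2 * n) * Real.exp (2 * d * (ν * n)) := by
          gcongr
          exact Nat.sub_le _ _
      _ = Real.exp (2 * n * Real.log W + 2 * d * (ν * n)) := by
          rw [Real.exp_add]
          congr 1
          rw [← Real.exp_log hW0, ← Real.exp_nat_mul, Real.log_exp]
          push_cast; rfl
      _ ≤ _ := by
          rw [Real.exp_le_exp]
          nlinarith [Nat.cast_nonneg (α := ℝ) n]

end PottsContour

theorem mainTheorem8 (d : ℕ) (hd : 2 ≤ d) (M : ℝ) (hM : 0 < M) (α : ℝ) (hα : (d : ℝ) < α) :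
    ∃ c₁ : ℝ, 0 < c₁ ∧ ∀ q : ℕ, 2 ≤ q → ∀ (y : Fin d → ℤ) (n : ℕ), 1 ≤ n →
      (PottsContour.contours q M (PottsContour.expo α d) y n).Finite ∧
      ((PottsContour.contours q M (PottsContour.expo α d) y n).ncard : ℝ) ≤
        Real.exp ((Real.log q + c₁) * n) := by
  have ha : 0 ≤ PottsContour.expo α d := by
    have : 0 < min (α - d) 1 := lt_min (by linarith) one_pos
    unfold PottsContour.expo
    positivity
  obtain ⟨c, hc, hS⟩ := PottsContour.exists_card_hasShortGaps_le hd hM.le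
    (s := 2 * (PottsContour.expo α d / ((d : ℝ) + 1))) (by positivity)
  refine ⟨c, hc, fun q hq y n _ => ?_⟩
  have : NeZero q := ⟨by omega⟩
  obtain ⟨S, hmem, hcard⟩ := hS y n
  let T : Finset (PottsContour.SpinPair d q) :=
    (S.filter fun G => G.card = n).sigma fun _ => Finset.univ
  have hT : PottsContour.contours q M (PottsContour.expo α d) y n ⊆ T := by
    rintro ⟨G, τ⟩ ⟨⟨σ, h, P, hP, hG, -⟩, hy, hn⟩
    simp only [T, Finset.mem_coe, Finset.mem_sigma, Finset.mem_filter, Finset.mem_univ, and_true]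
    exact ⟨hmem G (hP.hasShortGaps hd hM.le ha hG) hy hn, hn⟩
  have hTcard : T.card = (S.filter fun G => G.card = n).card * q ^ n := by
    rw [Finset.card_sigma, Finset.sum_const_nat]
    intro G hG
    simp [ZMod.card, (Finset.mem_filter.1 hG).2]
  refine ⟨T.finite_toSet.subset hT, ?_⟩
  have hq0 : (0 : ℝ) < q := by exact_mod_cast (by omega : 0 < q)
  calc ((PottsContour.contours q M (PottsContour.expo α d) y n).ncard : ℝ) ≤ T.card := by
        rw [← Set.ncard_coe_finset]
        exact_mod_cast Set.ncard_le_ncard hT T.finite_toSet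
    _ ≤ S.card * (q : ℝ) ^ n := by
        rw [hTcard]
        push_cast
        gcongr
        exact Finset.filter_subset _ _
    _ ≤ Real.exp (c * n) * (q : ℝ) ^ n := by gcongr
    _ = Real.exp ((Real.log q + c) * n) := by
        rw [add_mul, add_comm, Real.exp_add]
        congr 1
        rw [mul_comm, Real.exp_nat_mul, Real.exp_log hq0]
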